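/- Let $f:\mathbb{R}^n\to\mathbb{R}$ be locally Lipschitz, and let $B(x,\varepsilon)$ denote the closed Euclidean ball with center $x$ and radius $\varepsilon$. The Clarke generalized gradient of $f$ at $x$ is $$\bar\partial f(x):=\operatorname{conv}\Big\{\lim_{k\to\infty}\nabla f(x_k)\;\Big|\;x_k\to x,\ x_k\in A\Big\},$$ where $A$ is any full-measure subset of a neighborhood of $x$ at all of whose points $f$ is differentiable (the set obtained is the same for every such $A$; for definiteness one may take for $A$ the set of all points at which $f$ is differentiable). For a set $\mathcal D_f\subset\mathbb{R}^n$ of full measure at all of whose points $f$ is differentiable, and $\varepsilon>0$, put $$G_\varepsilon(x):=\operatorname{cl}\operatorname{conv}\big(\nabla f(B(x,\varepsilon)\cap\mathcal D_f)\big),\qquad \mathring G_\varepsilon(x):=\operatorname{cl}\operatorname{conv}\big(\nabla f(\operatorname{int}B(x,\varepsilon)\cap\mathcal D_f)\big).$$ Then, for every such $\mathcal D_f$ and every $x\in\mathbb{R}^n$: (i) $\bar\partial f(x)=\bigcap_{\varepsilon>0}G_\varepsilon(x)$. (ii) For each $\rho>0$ there exists $\varepsilon_0>0$ such that $G_\varepsilon(x)\subset\bigcup_{v\in\bar\partial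 f(x)}B(v,\rho)$ for all $\varepsilon\in(0,\varepsilon_0]$. (iii) For each $\varepsilon>0$, $\bigcup_{x'\in\operatorname{int}B(x,\varepsilon)}\bar\partial f(x')\subset G_\varepsilon(x)$. (iv) For each $\varepsilon>0$, $$G_\varepsilon(x)=\mathring G_\varepsilon(x)=\operatorname{cl}\operatorname{conv}\Big(\bigcup_{x'\in\operatorname{int}B(x,\varepsilon)}\bar\partial f(x')\Big).$$ Moreover, for each $x$ and each $\varepsilon>0$, both $G_\varepsilon(x)$ and $\mathring G_\varepsilon(x)$ are independent of the choice of the full-measure set $\mathcal D_f$ on which $f$ is differentiable. -/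

import Mathlib

open MeasureTheory Filter Topology

/-- `D` is a set of full measure in `ℝⁿ` at all of whose points `f` is differentiable. -/
def IsFullMeasureDiffSet {n : ℕ} (f : EuclideanSpace ℝ (Fin n) → ℝ)
    (D : Set (EuclideanSpace ℝ (Fin n))) : Prop :=
  volume Dᶜ = 0 ∧ ∀ y ∈ D, DifferentiableAt ℝ f y

/-- `A` is a full-measure subset of some neighborhood of `x`, and `f` is differentiable at
all points of `A`. -/
def IsLocalFullMeasureDiffSet {n : ℕ} (f : EuclideanSpace ℝ (Fin n) → ℝ)
    (x : EuclideanSpace ℝ (Fin n)) (A : Set (EuclideanSpace ℝ (Fin n))) : Prop :=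
  (∃ U ∈ 𝓝 x, A ⊆ U ∧ volume (U \ A) = 0) ∧ ∀ y ∈ A, DifferentiableAt ℝ f y

/-- The convex hull of all limits `lim ∇f(xₖ)` along sequences `xₖ → x` with `xₖ ∈ A`. -/
noncomputable def clarkeGradientAlong {n : ℕ} (f : EuclideanSpace ℝ (Fin n) → ℝ)
    (A : Set (EuclideanSpace ℝ (Fin n))) (x : EuclideanSpace ℝ (Fin n)) :
    Set (EuclideanSpace ℝ (Fin n)) :=
  convexHull ℝ {v | ∃ u : ℕ → EuclideanSpace ℝ (Fin n), (∀ k, u k ∈ A) ∧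
    Tendsto u atTop (𝓝 x) ∧ Tendsto (fun k => gradient f (u k)) atTop (𝓝 v)}

/-- The Clarke generalized gradient of `f` at `x`, computed along the set of all points at
which `f` is differentiable. -/
noncomputable def clarkeGradient {n : ℕ} (f : EuclideanSpace ℝ (Fin n) → ℝ)
    (x : EuclideanSpace ℝ (Fin n)) : Set (EuclideanSpace ℝ (Fin n)) :=
  clarkeGradientAlong f {y | DifferentiableAt ℝ f y} x

/-- `G_ε(x) = cl conv ∇f(B(x, ε) ∩ D)`, with `B(x, ε)` the closed ball. -/
noncomputable def gradientHull {n : ℕ} (f : EuclideanSpace ℝ (Fin n) → ℝ)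
    (D : Set (EuclideanSpace ℝ (Fin n))) (ε : ℝ) (x : EuclideanSpace ℝ (Fin n)) :
    Set (EuclideanSpace ℝ (Fin n)) :=
  closure (convexHull ℝ (gradient f '' (Metric.closedBall x ε ∩ D)))

/-- The analogue of `gradientHull` over the interior of the ball `B(x, ε)`. -/
noncomputable def openGradientHull {n : ℕ} (f : EuclideanSpace ℝ (Fin n) → ℝ)
    (D : Set (EuclideanSpace ℝ (Fin n))) (ε : ℝ) (x : EuclideanSpace ℝ (Fin n)) :
    Set (EuclideanSpace ℝ (Fin n)) :=
  closure (convexHull ℝ (gradient f '' (Metric.ball x ε ∩ D)))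

/-- The `ρ`-inflation of a set: the union of the closed `ρ`-balls around its points. -/
def inflation {n : ℕ} (S : Set (EuclideanSpace ℝ (Fin n))) (ρ : ℝ) :
    Set (EuclideanSpace ℝ (Fin n)) :=
  ⋃ y ∈ S, Metric.closedBall y ρ

/-!
The whole statement rests on one approximation result, `gradient_mem_closure_convexHull`: if `U` is
open and convex and `D ⊆ U` misses only a null set of `U`, then at every point `y` of the *closed*
set `closure U` where `f` is differentiable, `∇f(y)` lies in the closed convex hull of `∇f(D)`.

Suppose not, and separate: there are a direction `w` and a constant `c` with `⟪∇f(z), w⟫ ≤ c` for all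
`z ∈ D` but `⟪∇f(y), w⟫ > c`. By Fubini, almost every line parallel to `w` meets `U \ D` in a
one-dimensional null set; `f` is absolutely continuous on such lines, so the fundamental theorem of
calculus together with continuity of `f` gives `f(p + tw) - f(p) ≤ ct` whenever `p` and `p + tw` lie
in `U` (`sub_le_of_ae_fderiv_le`). Fix `a` pointing from `y` into the interior of `U`, so steeply
that `a + w` does too. Then `y + ta` and `y + t(a + w)` belong to `U` for small `t > 0`, and the
difference of the values of `f` there is `t⟪∇f(y), w⟫ + o(t)`. Hence `⟪∇f(y), w⟫ ≤ c`, a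
contradiction. Taking `y` on the boundary sphere of a ball shows that the closed and the open ball
give the same hull, and taking `y` inside shows independence of the full-measure set.

The other ingredient is compactness. The set of limits of gradients at `x` is compact, since the
gradient is locally bounded and the limits form a slice of a closed set; its convex hull is compact
by Carathéodory's theorem. Therefore the gradients at points near `x` lie in any prescribed closed
thickening of the Clarke gradient, which is closed and convex and so contains their closed convex
hull (`exists_gradientHull_subset_cthickening`).
-/

/-! ### Compactness of convex hulls in finite dimension -/

/-- By Carathéodory's theorem the hull is a finite union, over the number `k` of points used, of
continuous images of the compact sets `stdSimplex ℝ (Fin k) × sᵏ`. -/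
theorem IsCompact.convexHull_of_finiteDimensional {E : Type*} [NormedAddCommGroup E]
    [NormedSpace ℝ E] [FiniteDimensional ℝ E] {s : Set E} (hs : IsCompact s) :
    IsCompact (convexHull ℝ s) := by
  have key : convexHull ℝ s = ⋃ k ∈ Finset.range (Module.finrank ℝ E + 2),
      (fun p : (Fin k → ℝ) × (Fin k → E) => ∑ i, p.1 i • p.2 i) ''
        (stdSimplex ℝ (Fin k) ×ˢ Set.univ.pi fun _ => s) := by
    apply Set.Subset.antisymm
    · intro x hx
      obtain ⟨ι, _, z, w, hz, hind, hw, hw1, rfl⟩ := eq_pos_convex_span_of_mem_convexHull hx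
      have hcard : Fintype.card ι ≤ Module.finrank ℝ E + 1 :=
        hind.card_le_finrank_succ.trans (Nat.succ_le_succ (Submodule.finrank_le _))
      let e := Fintype.equivFin ι
      refine Set.mem_iUnion₂.2 ⟨Fintype.card ι, Finset.mem_range.2 (by omega),
        (w ∘ e.symm, z ∘ e.symm), ⟨⟨fun i => (hw _).le, ?_⟩, fun i _ => hz ⟨_, rfl⟩⟩, ?_⟩
      · exact (Equiv.sum_comp e.symm w).trans hw1
      · exact Equiv.sum_comp e.symm fun i => w i • z i
    · refine Set.iUnion₂_subset fun k _ => ?_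
      rintro _ ⟨⟨w, z⟩, ⟨⟨hw, hw1⟩, hz⟩, rfl⟩
      exact (convex_convexHull ℝ s).sum_mem (fun i _ => hw i) hw1
        fun i _ => subset_convexHull ℝ s (hz i trivial)
  rw [key]
  refine (Finset.range _).isCompact_biUnion fun k _ => ?_
  exact ((isCompact_stdSimplex ℝ (Fin k)).prod (isCompact_univ_pi fun _ => hs)).image
    (by fun_prop)

/-! ### A mean value inequality for locally Lipschitz functions -/

section MeanValue

variable {E : Type*} [NormedAddCommGroup E] [NormedSpace ℝ E]

/-- If the derivative bound holds almost everywhere on a segment, it integrates along it, because a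
Lipschitz function is absolutely continuous on the segment. -/
theorem LocallyLipschitz.sub_le_of_ae_fderiv_segment_le {f : E → ℝ} (hf : LocallyLipschitz f)
    {p w : E} {c : ℝ} (h : ∀ᵐ t : ℝ, t ∈ Set.Icc (0 : ℝ) 1 →
      DifferentiableAt ℝ f (p + t • w) ∧ fderiv ℝ f (p + t • w) w ≤ c) :
    f (p + w) - f p ≤ c := by
  have hline : LocallyLipschitz fun t : ℝ => p + t • w :=
    ContDiff.locallyLipschitz (𝕂 := ℝ) (by fun_prop)
  obtain ⟨K, hK⟩ := (hf.comp hline).locallyLipschitzOn.exists_lipschitzOnWith_of_compact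
    (isCompact_uIcc (a := (0 : ℝ)) (b := 1))
  have hac := hK.absolutelyContinuousOnInterval
  have hint := hac.integral_deriv_eq_sub
  have hle : ∫ t in (0 : ℝ)..1, deriv (f ∘ fun t : ℝ => p + t • w) t ≤ ∫ _ in (0 : ℝ)..1, c := by
    refine intervalIntegral.integral_mono_ae_restrict zero_le_one hac.intervalIntegrable_deriv
      (by simp) ?_
    refine (ae_restrict_iff' measurableSet_Icc).2 ?_
    filter_upwards [h] with t ht hmem
    obtain ⟨hd, hc⟩ := ht hmem
    have hl : HasDerivAt (fun t : ℝ => p + t • w) w t := by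
      simpa using ((hasDerivAt_id t).smul_const w).const_add p
    rw [(hd.hasFDerivAt.comp_hasDerivAt t hl).deriv]
    exact hc
  rw [hint] at hle
  simpa using hle

variable [FiniteDimensional ℝ E] [MeasurableSpace E] [BorelSpace E]

/-- By Fubini the derivative bound holds along almost every segment parallel to `w`; continuity of
`f` then reaches the remaining segments. -/
theorem LocallyLipschitz.sub_le_of_ae_fderiv_le {f : E → ℝ} (hf : LocallyLipschitz f)
    (μ : Measure E) [μ.IsAddHaarMeasure] {U D : Set E} (hU : IsOpen U) (hconv : Convex ℝ U)
    (hD : μ (U \ D) = 0) (hdiff : ∀ z ∈ D, DifferentiableAt ℝ f z) {w : E} {c : ℝ}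
    (hc : ∀ z ∈ D, fderiv ℝ f z w ≤ c) {p : E} (hp : p ∈ U) (hpw : p + w ∈ U) :
    f (p + w) - f p ≤ c := by
  set N := toMeasurable μ (U \ D)
  have hN : μ N = 0 := by rw [measure_toMeasurable, hD]
  have hfub : ∀ᵐ q ∂μ, ∀ᵐ t : ℝ, q + t • w ∉ N := by
    rw [Measure.ae_ae_comm]
    · refine Eventually.of_forall fun t => ?_
      exact (measurePreserving_add_right μ (t • w)).quasiMeasurePreserving.ae
        (measure_eq_zero_iff_ae_notMem.1 hN)
    · exact ((measurableSet_toMeasurable _ _).preimage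
        (by fun_prop : Measurable fun x : E × ℝ => x.1 + x.2 • w)).compl
  have hae : ∀ᵐ q ∂μ, q ∈ U → q + w ∈ U → f (q + w) - f q ≤ c := by
    filter_upwards [hfub] with q hq hqU hqwU
    refine hf.sub_le_of_ae_fderiv_segment_le ?_
    filter_upwards [hq] with t ht hmem
    have htU : q + t • w ∈ U := hconv.add_smul_mem hqU hqwU hmem
    have htD : q + t • w ∈ D := by
      by_contra hn
      exact ht (subset_toMeasurable μ _ ⟨htU, hn⟩)
    exact ⟨hdiff _ htD, hc _ htD⟩
  have hV : IsOpen (U ∩ (fun q => q + w) ⁻¹' U) := hU.inter (hU.preimage (by fun_prop))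
  have hS : IsClosed {q | f (q + w) - f q ≤ c} :=
    isClosed_le ((hf.continuous.comp (by fun_prop)).sub hf.continuous) continuous_const
  refine hS.closure_subset_iff.2 ?_
    ((Measure.dense_of_ae hae).open_subset_closure_inter hV ⟨hp, hpw⟩)
  rintro q ⟨⟨hqU, hqwU⟩, hq⟩
  exact hq hqU hqwU

/-- A one-sided bound on directional derivatives over almost all of an open convex set persists at
points of its closure, boundary points included. -/
theorem LocallyLipschitz.fderiv_le_of_mem_closure {f : E → ℝ} (hf : LocallyLipschitz f)
    (μ : Measure E) [μ.IsAddHaarMeasure] {U D : Set E} (hU : IsOpen U) (hconv : Convex ℝ U)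
    (hD : μ (U \ D) = 0) (hdiff : ∀ z ∈ D, DifferentiableAt ℝ f z) {w : E} {c : ℝ}
    (hc : ∀ z ∈ D, fderiv ℝ f z w ≤ c) {y : E} (hy : y ∈ closure U)
    (hfy : DifferentiableAt ℝ f y) : fderiv ℝ f y w ≤ c := by
  obtain ⟨x, hx⟩ := closure_nonempty_iff.1 ⟨y, hy⟩
  obtain ⟨M, hM, hxM⟩ : ∃ M : ℝ, 0 < M ∧ x + M⁻¹ • w ∈ U := by
    have hlim : Tendsto (fun M : ℝ => x + M⁻¹ • w) atTop (𝓝 x) := by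
      simpa using ((tendsto_inv_atTop_zero (𝕜 := ℝ)).smul_const w).const_add x
    exact ((eventually_gt_atTop 0).and (hlim.eventually (hU.mem_nhds hx))).exists
  -- `y + t • M • (u - y)` is a convex combination of `y` and the interior point `u`.
  have hmem : ∀ u ∈ U, ∀ᶠ t : ℝ in 𝓝[>] 0, y + t • M • (u - y) ∈ U := by
    intro u hu
    filter_upwards [Ioo_mem_nhdsGT (inv_pos.2 hM)] with t ht
    have htM : t * M < 1 := by
      have := mul_lt_mul_of_pos_right ht.2 hM
      rwa [inv_mul_cancel₀ hM.ne'] at this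
    have := hconv.combo_closure_interior_mem_interior hy (hU.interior_eq.symm ▸ hu)
      (sub_nonneg.2 htM.le) (mul_pos ht.1 hM) (sub_add_cancel 1 (t * M))
    rw [hU.interior_eq] at this
    convert this using 1
    module
  set a := M • (x - y)
  have hb : M • (x + M⁻¹ • w - y) = a + w := by
    rw [add_sub_right_comm, smul_add, smul_inv_smul₀ hM.ne']
  have hslope : ∀ v : E, Tendsto (fun t : ℝ => t⁻¹ • (f (y + t • v) - f y)) (𝓝[>] 0)
      (𝓝 (fderiv ℝ f y v)) := fun v =>
    (hfy.hasFDerivAt.hasLineDerivAt v).tendsto_slope_zero_right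
  have hlim := (hslope (a + w)).sub (hslope a)
  rw [map_add, add_sub_cancel_left] at hlim
  refine le_of_tendsto hlim ?_
  filter_upwards [hmem _ hx, hmem _ hxM, self_mem_nhdsWithin] with t hat hbt ht
  rw [hb] at hbt
  have ht : 0 < t := ht
  have hsplit : y + t • (a + w) = (y + t • a) + t • w := by module
  rw [hsplit] at hbt ⊢
  have hmv : f (y + t • a + t • w) - f (y + t • a) ≤ t * c :=
    hf.sub_le_of_ae_fderiv_le μ hU hconv hD hdiff
      (fun z hz => by simpa using mul_le_mul_of_nonneg_left (hc z hz) ht.le) hat hbt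
  rw [← smul_sub, sub_sub_sub_cancel_right, smul_eq_mul, inv_mul_le_iff₀ ht]
  exact hmv

end MeanValue

/-! ### Closed convex hulls of gradients -/

section Gradient

variable {E : Type*} [NormedAddCommGroup E] [InnerProductSpace ℝ E] [FiniteDimensional ℝ E]

/-- The gradient at a point of the closure of an open convex set belongs to the closed convex hull
of the gradients at almost all points of that set. -/
theorem LocallyLipschitz.gradient_mem_closure_convexHull [MeasurableSpace E] [BorelSpace E]
    {f : E → ℝ} (hf : LocallyLipschitz f)
    (μ : Measure E) [μ.IsAddHaarMeasure] {U D : Set E} (hU : IsOpen U) (hconv : Convex ℝ U)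
    (hD : μ (U \ D) = 0) (hdiff : ∀ z ∈ D, DifferentiableAt ℝ f z) {y : E} (hy : y ∈ closure U)
    (hfy : DifferentiableAt ℝ f y) :
    gradient f y ∈ closure (convexHull ℝ (gradient f '' (U ∩ D))) := by
  by_contra hn
  obtain ⟨φ, c, hφ, hc⟩ := geometric_hahn_banach_closed_point
    (convex_convexHull ℝ _).closure isClosed_closure hn
  set w := (InnerProductSpace.toDual ℝ E).symm φ
  have hw : ∀ z, φ (gradient f z) = fderiv ℝ f z w := fun z => by
    rw [← inner_gradient_left, real_inner_comm, InnerProductSpace.toDual_symm_apply]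
  rw [hw] at hc
  refine hc.not_ge (hf.fderiv_le_of_mem_closure μ hU hconv (D := U ∩ D) ?_
    (fun z hz => hdiff z hz.2) (fun z hz => ?_) hy hfy)
  · rwa [Set.sdiff_self_inter]
  · rw [← hw]
    exact (hφ _ (subset_closure (subset_convexHull ℝ _ ⟨z, hz, rfl⟩))).le

theorem LocallyLipschitz.exists_norm_gradient_le {f : E → ℝ} (hf : LocallyLipschitz f) (x : E) :
    ∃ K r : ℝ, 0 < r ∧ ∀ y ∈ Metric.ball x r, ‖gradient f y‖ ≤ K := by
  obtain ⟨K, t, ht, hK⟩ := hf x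
  obtain ⟨r, hr, hrt⟩ := Metric.mem_nhds_iff.1 ht
  refine ⟨K, r, hr, fun y hy => ?_⟩
  rw [gradient, LinearIsometryEquiv.norm_map]
  exact norm_fderiv_le_of_lipschitzOn ℝ (Metric.isOpen_ball.mem_nhds hy) (hK.mono hrt)

/-- The limits of `∇f(uₖ)` along sequences `uₖ → x` in `A`, whose convex hull is the Clarke
generalized gradient. -/
def limitingGradients (f : E → ℝ) (A : Set E) (x : E) : Set E :=
  {v | ∃ u : ℕ → E, (∀ k, u k ∈ A) ∧ Tendsto u atTop (𝓝 x) ∧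
    Tendsto (fun k => gradient f (u k)) atTop (𝓝 v)}

/-- The limiting gradients at `x` form the slice over `x` of the closed graph of the gradient. -/
theorem isClosed_limitingGradients (f : E → ℝ) (A : Set E) (x : E) :
    IsClosed (limitingGradients f A x) := by
  have : limitingGradients f A x =
      (fun v => (x, v)) ⁻¹' closure ((fun y => (y, gradient f y)) '' A) := by
    ext v
    rw [Set.mem_preimage, mem_closure_iff_seq_limit]
    constructor
    · rintro ⟨u, hu, hux, huv⟩
      exact ⟨fun k => (u k, gradient f (u k)), fun k => ⟨u k, hu k, rfl⟩, hux.prodMk_nhds huv⟩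
    · rintro ⟨g, hg, hlim⟩
      choose u hu hug using hg
      obtain rfl : (fun k => (u k, gradient f (u k))) = g := funext hug
      exact ⟨u, hu, hlim.fst_nhds, hlim.snd_nhds⟩
  rw [this]
  exact isClosed_closure.preimage (by fun_prop)

theorem LocallyLipschitz.isCompact_limitingGradients {f : E → ℝ} (hf : LocallyLipschitz f)
    (A : Set E) (x : E) : IsCompact (limitingGradients f A x) := by
  obtain ⟨K, r, hr, hK⟩ := hf.exists_norm_gradient_le x
  refine (isCompact_closedBall (0 : E) K).of_isClosed_subset
    (isClosed_limitingGradients f A x) ?_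
  rintro v ⟨u, -, hux, huv⟩
  rw [mem_closedBall_zero_iff]
  refine le_of_tendsto huv.norm ?_
  filter_upwards [hux.eventually (Metric.ball_mem_nhds x hr)] with k hk using hK _ hk

/-- Gradients near `x` are close to limiting gradients at `x`: otherwise, as the gradient is locally
bounded, a sequence of exceptions would have a subsequential limit, which is a limiting gradient. -/
theorem LocallyLipschitz.exists_gradient_mem_thickening {f : E → ℝ} (hf : LocallyLipschitz f)
    (A : Set E) (x : E) {ρ : ℝ} (hρ : 0 < ρ) :
    ∃ ε, 0 < ε ∧ ∀ y ∈ Metric.closedBall x ε ∩ A,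
      gradient f y ∈ Metric.thickening ρ (limitingGradients f A x) := by
  obtain ⟨K, r, hr, hK⟩ := hf.exists_norm_gradient_le x
  by_contra! h
  have hpos : ∀ k : ℕ, 0 < r / 2 * (1 / ((k : ℝ) + 1)) := fun k => by positivity
  choose u hu hun using fun k => h _ (hpos k)
  have hux : Tendsto u atTop (𝓝 x) := by
    rw [tendsto_iff_dist_tendsto_zero]
    refine squeeze_zero (fun _ => dist_nonneg) (fun k => (hu k).1) ?_
    simpa using tendsto_one_div_add_atTop_nhds_zero_nat.const_mul (r / 2)
  have hbdd : ∀ k, gradient f (u k) ∈ Metric.closedBall (0 : E) K := by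
    intro k
    rw [mem_closedBall_zero_iff]
    refine hK _ (Metric.mem_ball.2 (lt_of_le_of_lt (Metric.mem_closedBall.1 (hu k).1) ?_))
    have : 1 / ((k : ℝ) + 1) ≤ 1 := div_le_one_of_le₀ (by simp) (by positivity)
    nlinarith
  obtain ⟨v, -, φ, hφ, hlim⟩ := (isCompact_closedBall (0 : E) K).tendsto_subseq hbdd
  have hv : v ∈ limitingGradients f A x :=
    ⟨u ∘ φ, fun k => (hu _).2, hux.comp hφ.tendsto_atTop, hlim⟩
  obtain ⟨k, hk⟩ := (hlim.eventually (Metric.isOpen_thickening.mem_nhds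
    (Metric.self_subset_thickening hρ _ hv))).exists
  exact hun _ hk

end Gradient

/-! ### The Clarke gradient -/

section Clarke

variable {n : ℕ} {f : EuclideanSpace ℝ (Fin n) → ℝ} {x : EuclideanSpace ℝ (Fin n)}

theorem LocallyLipschitz.isCompact_clarkeGradientAlong (hf : LocallyLipschitz f)
    (A : Set (EuclideanSpace ℝ (Fin n))) (x : EuclideanSpace ℝ (Fin n)) :
    IsCompact (clarkeGradientAlong f A x) :=
  (hf.isCompact_limitingGradients A x).convexHull_of_finiteDimensional

theorem clarkeGradientAlong_mono {A B : Set (EuclideanSpace ℝ (Fin n))} (h : A ⊆ B) :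
    clarkeGradientAlong f A x ⊆ clarkeGradientAlong f B x :=
  convexHull_mono fun _ ⟨u, hu, hlim⟩ => ⟨u, fun k => h (hu k), hlim⟩

/-- Only the points of `A` near `x` matter for the Clarke gradient at `x`. -/
theorem clarkeGradientAlong_subset_closure_convexHull {A V : Set (EuclideanSpace ℝ (Fin n))}
    (hV : V ∈ 𝓝 x) :
    clarkeGradientAlong f A x ⊆ closure (convexHull ℝ (gradient f '' (V ∩ A))) := by
  refine convexHull_min ?_ (convex_convexHull ℝ _).closure
  rintro v ⟨u, hu, hux, huv⟩
  refine mem_closure_of_tendsto huv ?_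
  filter_upwards [hux.eventually hV] with k hk
  exact subset_convexHull ℝ _ ⟨u k, ⟨hk, hu k⟩, rfl⟩

/-- Upper semicontinuity of the Clarke gradient, for hulls of gradients over closed balls. -/
theorem LocallyLipschitz.exists_gradientHull_subset_cthickening
    (hf : LocallyLipschitz f) (A : Set (EuclideanSpace ℝ (Fin n)))
    (x : EuclideanSpace ℝ (Fin n)) {ρ : ℝ} (hρ : 0 < ρ) :
    ∃ ε₀, 0 < ε₀ ∧ ∀ ε ≤ ε₀,
      gradientHull f A ε x ⊆ Metric.cthickening ρ (clarkeGradientAlong f A x) := by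
  obtain ⟨ε₀, hε₀, h⟩ := hf.exists_gradient_mem_thickening A x hρ
  refine ⟨ε₀, hε₀, fun ε hε => ?_⟩
  refine closure_minimal (convexHull_min ?_ ((convex_convexHull ℝ _).cthickening ρ))
    Metric.isClosed_cthickening
  rintro _ ⟨y, ⟨hy, hyA⟩, rfl⟩
  exact Metric.cthickening_subset_of_subset ρ (subset_convexHull ℝ _)
    (Metric.thickening_subset_cthickening _ _ (h y ⟨Metric.closedBall_subset_closedBall hε hy, hyA⟩))

theorem LocallyLipschitz.iInter_gradientHull_subset (hf : LocallyLipschitz f)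
    (A : Set (EuclideanSpace ℝ (Fin n))) (x : EuclideanSpace ℝ (Fin n)) :
    (⋂ (ε : ℝ) (_ : 0 < ε), gradientHull f A ε x) ⊆ clarkeGradientAlong f A x := by
  intro v hv
  rw [← (hf.isCompact_clarkeGradientAlong A x).isClosed.closure_eq,
    Metric.closure_eq_iInter_cthickening]
  refine Set.mem_iInter₂.2 fun ρ hρ => ?_
  obtain ⟨ε, hε, h⟩ := hf.exists_gradientHull_subset_cthickening A x hρ
  exact h ε le_rfl (Set.mem_iInter₂.1 hv ε hε)

theorem gradientHull_mono {A : Set (EuclideanSpace ℝ (Fin n))} {ε δ : ℝ} (h : ε ≤ δ) :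
    gradientHull f A ε x ⊆ gradientHull f A δ x :=
  closure_mono (convexHull_mono (Set.image_mono
    (Set.inter_subset_inter_left _ (Metric.closedBall_subset_closedBall h))))

theorem openGradientHull_subset_gradientHull (A : Set (EuclideanSpace ℝ (Fin n))) (ε : ℝ) :
    openGradientHull f A ε x ⊆ gradientHull f A ε x :=
  closure_mono (convexHull_mono (Set.image_mono
    (Set.inter_subset_inter_left _ Metric.ball_subset_closedBall)))

/-- Replacing almost all points of the open ball by arbitrary points of differentiability in the
closed ball does not enlarge the closed convex hull of the gradients. -/
theorem LocallyLipschitz.gradientHull_subset_openGradientHull (hf : LocallyLipschitz f)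
    {A B : Set (EuclideanSpace ℝ (Fin n))} {ε : ℝ} (hε : 0 < ε)
    (hA : ∀ y ∈ A, DifferentiableAt ℝ f y) (hB : ∀ y ∈ B, DifferentiableAt ℝ f y)
    (hnull : volume (Metric.ball x ε \ B) = 0) :
    gradientHull f A ε x ⊆ openGradientHull f B ε x := by
  refine closure_minimal (convexHull_min ?_ (convex_convexHull ℝ _).closure) isClosed_closure
  rintro _ ⟨y, ⟨hy, hyA⟩, rfl⟩
  rw [← closure_ball x hε.ne'] at hy
  exact hf.gradient_mem_closure_convexHull volume Metric.isOpen_ball (convex_ball x ε) hnull hB hy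
    (hA y hyA)

theorem LocallyLipschitz.clarkeGradientAlong_eq_clarkeGradient (hf : LocallyLipschitz f)
    {A : Set (EuclideanSpace ℝ (Fin n))} (hA : IsLocalFullMeasureDiffSet f x A) :
    clarkeGradientAlong f A x = clarkeGradient f x := by
  obtain ⟨⟨U, hU, -, hnull⟩, hdiff⟩ := hA
  refine (clarkeGradientAlong_mono hdiff).antisymm ?_
  refine Set.Subset.trans ?_ (hf.iInter_gradientHull_subset A x)
  refine Set.subset_iInter₂ fun ε hε => ?_
  obtain ⟨r, hr, hrU⟩ := Metric.mem_nhds_iff.1 hU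
  have hδ : 0 < min ε r := lt_min hε hr
  calc clarkeGradient f x
      ⊆ gradientHull f {y | DifferentiableAt ℝ f y} (min ε r) x :=
        clarkeGradientAlong_subset_closure_convexHull (Metric.closedBall_mem_nhds x hδ)
    _ ⊆ openGradientHull f A (min ε r) x :=
        hf.gradientHull_subset_openGradientHull hδ (fun _ h => h) hdiff (measure_mono_null
          (Set.sdiff_subset_sdiff_left
            ((Metric.ball_subset_ball (min_le_right _ _)).trans hrU)) hnull)
    _ ⊆ gradientHull f A (min ε r) x := openGradientHull_subset_gradientHull A _
    _ ⊆ gradientHull f A ε x := gradientHull_mono (min_le_left _ _)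

theorem gradient_mem_clarkeGradient {y : EuclideanSpace ℝ (Fin n)} (hy : DifferentiableAt ℝ f y) :
    gradient f y ∈ clarkeGradient f y :=
  subset_convexHull ℝ _ ⟨fun _ => y, fun _ => hy, tendsto_const_nhds, tendsto_const_nhds⟩

variable {D : Set (EuclideanSpace ℝ (Fin n))}

theorem IsFullMeasureDiffSet.isLocalFullMeasureDiffSet (hD : IsFullMeasureDiffSet f D)
    (x : EuclideanSpace ℝ (Fin n)) : IsLocalFullMeasureDiffSet f x D :=
  ⟨⟨Set.univ, univ_mem, Set.subset_univ D, by rw [← Set.compl_eq_univ_sdiff]; exact hD.1⟩, hD.2⟩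

theorem IsFullMeasureDiffSet.volume_sdiff_eq_zero (hD : IsFullMeasureDiffSet f D)
    (U : Set (EuclideanSpace ℝ (Fin n))) : volume (U \ D) = 0 :=
  measure_mono_null (fun _ h => h.2) hD.1

theorem LocallyLipschitz.iUnion_clarkeGradient_subset_openGradientHull (hf : LocallyLipschitz f)
    (hD : IsFullMeasureDiffSet f D) (x : EuclideanSpace ℝ (Fin n)) (ε : ℝ) :
    (⋃ x' ∈ Metric.ball x ε, clarkeGradient f x') ⊆ openGradientHull f D ε x := by
  refine Set.iUnion₂_subset fun x' hx' => ?_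
  rw [← hf.clarkeGradientAlong_eq_clarkeGradient (hD.isLocalFullMeasureDiffSet x')]
  exact clarkeGradientAlong_subset_closure_convexHull (Metric.isOpen_ball.mem_nhds hx')

end Clarke

theorem mainTheorem5 (n : ℕ) (f : EuclideanSpace ℝ (Fin n) → ℝ) (hf : LocallyLipschitz f) :
    -- the Clarke gradient does not depend on the full-measure set used to define it
    (∀ (x : EuclideanSpace ℝ (Fin n)) (A : Set (EuclideanSpace ℝ (Fin n))),
      IsLocalFullMeasureDiffSet f x A → clarkeGradientAlong f A x = clarkeGradient f x) ∧
    (∀ D : Set (EuclideanSpace ℝ (Fin n)), IsFullMeasureDiffSet f D →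
      ∀ x : EuclideanSpace ℝ (Fin n),
        clarkeGradient f x = (⋂ (ε : ℝ) (_ : 0 < ε), gradientHull f D ε x) ∧
        (∀ ρ : ℝ, 0 < ρ → ∃ ε₀ : ℝ, 0 < ε₀ ∧ ∀ ε : ℝ, 0 < ε → ε ≤ ε₀ →
          gradientHull f D ε x ⊆ inflation (clarkeGradient f x) ρ) ∧
        (∀ ε : ℝ, 0 < ε →
          (⋃ x' ∈ Metric.ball x ε, clarkeGradient f x') ⊆ gradientHull f D ε x ∧
          gradientHull f D ε x = openGradientHull f D ε x ∧
          openGradientHull f D ε x =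
            closure (convexHull ℝ (⋃ x' ∈ Metric.ball x ε, clarkeGradient f x')))) ∧
    (∀ D D' : Set (EuclideanSpace ℝ (Fin n)),
      IsFullMeasureDiffSet f D → IsFullMeasureDiffSet f D' →
      ∀ (x : EuclideanSpace ℝ (Fin n)) (ε : ℝ), 0 < ε →
        gradientHull f D ε x = gradientHull f D' ε x ∧
        openGradientHull f D ε x = openGradientHull f D' ε x) := by
  have hopen : ∀ D D' : Set (EuclideanSpace ℝ (Fin n)), IsFullMeasureDiffSet f D →
      IsFullMeasureDiffSet f D' → ∀ (x : EuclideanSpace ℝ (Fin n)) (ε : ℝ), 0 < ε →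
      gradientHull f D ε x ⊆ openGradientHull f D' ε x := fun D D' hD hD' x ε hε =>
    hf.gradientHull_subset_openGradientHull hε hD.2 hD'.2 (hD'.volume_sdiff_eq_zero _)
  have hsub : ∀ (D : Set (EuclideanSpace ℝ (Fin n))) (x : EuclideanSpace ℝ (Fin n)) (ε : ℝ),
      openGradientHull f D ε x ⊆ gradientHull f D ε x := fun D _ ε =>
    openGradientHull_subset_gradientHull D ε
  refine ⟨fun x A hA => hf.clarkeGradientAlong_eq_clarkeGradient hA, fun D hD x => ?_, ?_⟩
  · have hx := hf.clarkeGradientAlong_eq_clarkeGradient (hD.isLocalFullMeasureDiffSet x)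
    refine ⟨?_, fun ρ hρ => ?_, fun ε hε => ⟨?_, ?_, ?_⟩⟩
    · rw [← hx]
      refine Set.Subset.antisymm (Set.subset_iInter₂ fun ε hε => ?_)
        (hf.iInter_gradientHull_subset D x)
      exact clarkeGradientAlong_subset_closure_convexHull (Metric.closedBall_mem_nhds x hε)
    · obtain ⟨ε₀, hε₀, h⟩ := hf.exists_gradientHull_subset_cthickening D x hρ
      refine ⟨ε₀, hε₀, fun ε _ hε => ?_⟩
      rw [inflation, ← hx,
        ← (hf.isCompact_clarkeGradientAlong D x).cthickening_eq_biUnion_closedBall hρ.le]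
      exact h ε hε
    · exact (hf.iUnion_clarkeGradient_subset_openGradientHull hD x ε).trans (hsub D x ε)
    · exact (hopen D D hD hD x ε hε).antisymm (hsub D x ε)
    · refine Set.Subset.antisymm (closure_mono (convexHull_mono ?_)) (closure_minimal
        (convexHull_min (hf.iUnion_clarkeGradient_subset_openGradientHull hD x ε)
          (convex_convexHull ℝ _).closure) isClosed_closure)
      rintro _ ⟨y, ⟨hy, hyD⟩, rfl⟩
      exact Set.mem_iUnion₂.2 ⟨y, hy, gradient_mem_clarkeGradient (hD.2 y hyD)⟩
  · intro D D' hD hD' x ε hε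
    exact ⟨((hopen D D' hD hD' x ε hε).trans (hsub D' x ε)).antisymm
        ((hopen D' D hD' hD x ε hε).trans (hsub D x ε)),
      ((hsub D x ε).trans (hopen D D' hD hD' x ε hε)).antisymm
        ((hsub D' x ε).trans (hopen D' D hD' hD x ε hε))⟩
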